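/- There are absolute constants $c, C > 0$ such that the following holds. Let $G=(V,E)$ be a finite simple $d$-regular graph, $d \ge 1$, on $N \ge 2$ vertices, and let $T \subset V$ be a set of marked vertices with $\emptyset \ne T \ne V$. Let $A$ be the normalized adjacency matrix, $A_{uv} = 1/d$ if $uv \in E$ and $A_{uv} = 0$ otherwise, with eigenvalues $\cos\phi_0 \ge \cos\phi_1 \ge \dots \ge \cos\phi_{N-1}$ (counted with multiplicity, $\cos\phi_0 = 1$), and let $g = 1 - \cos\phi_1$ be its spectral gap. Let $\tilde A_T$ be the leaking walk matrix, obtained from $A$ by deleting all rows and columns indexed by $T$, and let $\alpha \in [0,\pi]$ be such that $\cos\alpha$ is the principal (that is, largest) eigenvalue of $\tilde A_T$. Let $h_T$ be the average hitting time of $T$, that is, the expected number of steps that the simple random walk on $G$ (which moves at each step to a uniformly random neighbor), started at a uniformly random vertex of $V$, takes to reach $T$ (it is $0$ if the walk starts in $T$). If $g > 2\sin^2\alpha$, then $h_T = \Theta(1/\alpha^2)$, namely $\alpha > 0$ and $$\frac{c}{\alpha^2} \le h_T \le \frac{C}{\alpha^2}.$$ -/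

import Mathlib

open MeasureTheory ProbabilityTheory
open scoped ENNReal

noncomputable section

namespace RegularGraphWalk

/-- The normalized adjacency matrix of a `d`-regular graph: the entry at `(u, v)` is `1 / d` if
`u` and `v` are adjacent and `0` otherwise. -/
def normAdjMatrix {V : Type*} (G : SimpleGraph V) [DecidableRel G.Adj] (d : ℕ) : Matrix V V ℝ :=
  Matrix.of fun u v => if G.Adj u v then 1 / (d : ℝ) else 0

theorem normAdjMatrix_isHermitian {V : Type*} (G : SimpleGraph V) [DecidableRel G.Adj] (d : ℕ) :
    (normAdjMatrix G d).IsHermitian := by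
  ext u v
  simp [normAdjMatrix, G.adj_comm v u]

/-- The spectral gap `1 - cos φ₁` of the normalized adjacency matrix, where
`cos φ₀ ≥ cos φ₁ ≥ ⋯` are its eigenvalues in decreasing order, repeated according to
multiplicity (`cos φ₀ = 1` for a regular graph of positive degree). -/
def spectralGap {V : Type*} [Fintype V] [DecidableEq V] [Nontrivial V] (G : SimpleGraph V)
    [DecidableRel G.Adj] (d : ℕ) : ℝ :=
  1 - (normAdjMatrix_isHermitian G d).eigenvalues₀ ⟨1, Fintype.one_lt_card⟩

/-- The leaking walk matrix: the rows and columns of the marked vertices are removed from the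
normalized adjacency matrix. -/
def leakingWalkMatrix {V : Type*} (G : SimpleGraph V) [DecidableRel G.Adj] (d : ℕ)
    (T : Finset V) : Matrix {v // v ∉ T} {v // v ∉ T} ℝ :=
  (normAdjMatrix G d).submatrix Subtype.val Subtype.val

/-- `μ` is the principal (that is, the largest) eigenvalue of the real square matrix `B`. -/
def IsPrincipalEigenvalue {n : Type*} [Fintype n] [DecidableEq n] (B : Matrix n n ℝ) (μ : ℝ) :
    Prop :=
  IsGreatest {x : ℝ | Module.End.HasEigenvalue (Matrix.toLin' B) x} μ

/-- One step of the random walk from `u`: the walker moves to a uniformly random neighbor of `u`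
(a walker at a vertex without neighbors stays there). -/
def stepPMF {V : Type*} [Fintype V] [DecidableEq V] (G : SimpleGraph V) [DecidableRel G.Adj]
    (u : V) : PMF V :=
  if h : (G.neighborFinset u).Nonempty then PMF.uniformOfFinset (G.neighborFinset u) h
  else PMF.pure u

/-- The transition kernel at time `n`: the next vertex depends on the past only through the
current vertex, and is drawn from `stepPMF`. -/
def stepKernel {V : Type*} [Fintype V] [DecidableEq V] [MeasurableSpace V]
    [DiscreteMeasurableSpace V] (G : SimpleGraph V) [DecidableRel G.Adj] (n : ℕ) :
    Kernel (Finset.Iic n → V) V where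
  toFun x := (stepPMF G (x ⟨n, Finset.mem_Iic.mpr le_rfl⟩)).toMeasure
  measurable' := (Measurable.of_discrete (f := fun u : V => (stepPMF G u).toMeasure)).comp
    (measurable_pi_apply _)

instance {V : Type*} [Fintype V] [DecidableEq V] [MeasurableSpace V]
    [DiscreteMeasurableSpace V] (G : SimpleGraph V) [DecidableRel G.Adj] (n : ℕ) :
    IsMarkovKernel (stepKernel G n) :=
  ⟨fun x => inferInstanceAs (IsProbabilityMeasure (stepPMF G (x _)).toMeasure)⟩

/-- The law, on the space of infinite trajectories, of the random walk on `G` whose starting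
vertex is uniformly distributed. -/
def walkLaw {V : Type*} [Fintype V] [DecidableEq V] [Nonempty V] [MeasurableSpace V]
    [DiscreteMeasurableSpace V] (G : SimpleGraph V) [DecidableRel G.Adj] : Measure (ℕ → V) :=
  Kernel.trajMeasure (X := fun _ => V) (PMF.uniformOfFintype V).toMeasure (stepKernel G)

/-- The number of steps until the trajectory `ω` is in `T` for the first time: the least `n` with
`ω n ∈ T`, and `∞` if there is none. -/
def hittingTime {V : Type*} (T : Finset V) (ω : ℕ → V) : ℕ∞ :=
  hittingAfter (fun n (ω : ℕ → V) => ω n) (T : Set V) 0 ω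

/-- The average hitting time: the expected number of steps (possibly `∞`) that the random walk
started from the uniform distribution needs to reach `T`. -/
def averageHittingTime {V : Type*} [Fintype V] [DecidableEq V] [Nonempty V] [MeasurableSpace V]
    [DiscreteMeasurableSpace V] (G : SimpleGraph V) [DecidableRel G.Adj] (T : Finset V) : ℝ≥0∞ :=
  ∫⁻ ω, (hittingTime T ω : ℝ≥0∞) ∂(walkLaw G)

end RegularGraphWalk

end

noncomputable section

namespace RegularGraphWalk

open Matrix Filter Topology

/-! ### Quadratic forms of symmetric matrices and the second eigenvalue. -/

section Spectral

variable {n : Type*} [Fintype n] [DecidableEq n] {A : Matrix n n ℝ}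

/-! Let `B` be the leaking matrix, `μ = cos α`, `U` the unmarked set and `N` the number of vertices.
The walk avoids `T` through time `k` with probability `(1 ⬝ᵥ B ^ k *ᵥ 1) / N`, so the hitting time
is the sum over `k`, formally `1 ⬝ᵥ (1 - B)⁻¹ 1 / N`. Since `1 - B ≥ 1 - μ`, this is at most `(|U| /
N) / (1 - μ)`; a unit principal eigenvector `v` alone contributes `a / (1 - μ)` with `a = (v ⬝ᵥ 1) ^
2 / N`. Extending `v` by zero and using the gap `g` of the whole graph gives `g (1 - a) ≤ 1 - μ`
(`spectralGap_mul_one_sub_le`). As `μ ≥ 0`, `1 - μ ≤ sin² α < g / 2`, whence `a ≥ 1/2`. Finally `1 -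
cos α` is comparable to `α ^ 2`. -/

theorem dotProduct_eq_sum_eigenvectorBasis (hA : A.IsHermitian) (x y : n → ℝ) :
    x ⬝ᵥ y = ∑ i, (⇑(hA.eigenvectorBasis i) ⬝ᵥ x) * (⇑(hA.eigenvectorBasis i) ⬝ᵥ y) := by
  have h := hA.eigenvectorBasis.sum_inner_mul_inner (WithLp.toLp 2 x) (WithLp.toLp 2 y)
  simp only [EuclideanSpace.inner_eq_star_dotProduct, star_trivial] at h
  rw [dotProduct_comm, ← h]
  refine Finset.sum_congr rfl fun i _ => ?_
  rw [dotProduct_comm y]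

theorem eigenvectorBasis_dotProduct_mulVec (hA : A.IsHermitian) (x : n → ℝ) (i : n) :
    ⇑(hA.eigenvectorBasis i) ⬝ᵥ (A *ᵥ x) =
      hA.eigenvalues i * (⇑(hA.eigenvectorBasis i) ⬝ᵥ x) := by
  have hT : Aᵀ = A := by simpa using hA.eq
  rw [dotProduct_mulVec, ← mulVec_transpose, hT, hA.mulVec_eigenvectorBasis, smul_dotProduct,
    smul_eq_mul]

theorem dotProduct_mulVec_le_of_eigenvalues (hA : A.IsHermitian) {x : n → ℝ} {μ : ℝ}
    (h : ∀ i, ⇑(hA.eigenvectorBasis i) ⬝ᵥ x = 0 ∨ hA.eigenvalues i ≤ μ) :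
    x ⬝ᵥ (A *ᵥ x) ≤ μ * (x ⬝ᵥ x) := by
  rw [dotProduct_eq_sum_eigenvectorBasis hA x (A *ᵥ x), dotProduct_eq_sum_eigenvectorBasis hA x x,
    Finset.mul_sum]
  refine Finset.sum_le_sum fun i _ => ?_
  rw [eigenvectorBasis_dotProduct_mulVec]
  rcases h i with h | h
  · simp [h]
  · nlinarith [mul_self_nonneg (⇑(hA.eigenvectorBasis i) ⬝ᵥ x)]

theorem eigenvectorBasis_ne_zero (hA : A.IsHermitian) (i : n) :
    (⇑(hA.eigenvectorBasis i) : n → ℝ) ≠ 0 := by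
  intro h
  apply hA.eigenvectorBasis.orthonormal.ne_zero i
  ext j
  exact congrFun h j

theorem hasEigenvalue_toLin'_iff {μ : ℝ} :
    Module.End.HasEigenvalue (Matrix.toLin' A) μ ↔ ∃ v : n → ℝ, v ≠ 0 ∧ A *ᵥ v = μ • v := by
  constructor
  · intro h
    obtain ⟨v, hv⟩ := h.exists_hasEigenvector
    exact ⟨v, hv.2, by simpa using hv.apply_eq_smul⟩
  · rintro ⟨v, h0, hv⟩
    exact Module.End.hasEigenvalue_of_hasEigenvector
      (Module.End.hasEigenvector_iff.mpr ⟨Module.End.mem_eigenspace_iff.mpr (by simpa using hv), h0⟩)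

theorem IsPrincipalEigenvalue.dotProduct_mulVec_le {μ : ℝ} (hμ : IsPrincipalEigenvalue A μ)
    (hA : A.IsHermitian) (x : n → ℝ) : x ⬝ᵥ (A *ᵥ x) ≤ μ * (x ⬝ᵥ x) :=
  dotProduct_mulVec_le_of_eigenvalues hA fun i => Or.inr <| hμ.2 <|
    hasEigenvalue_toLin'_iff.mpr ⟨_, eigenvectorBasis_ne_zero hA i, hA.mulVec_eigenvectorBasis i⟩

theorem IsPrincipalEigenvalue.exists_unit_eigenvector {μ : ℝ} (hμ : IsPrincipalEigenvalue A μ) :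
    ∃ v : n → ℝ, v ⬝ᵥ v = 1 ∧ A *ᵥ v = μ • v := by
  obtain ⟨v, h0, hv⟩ := hasEigenvalue_toLin'_iff.mp hμ.1
  have hpos : 0 < v ⬝ᵥ v :=
    lt_of_le_of_ne (Finset.sum_nonneg fun i _ => mul_self_nonneg _)
      (fun h => h0 (dotProduct_self_eq_zero.mp h.symm))
  refine ⟨(√(v ⬝ᵥ v))⁻¹ • v, ?_, ?_⟩
  · rw [smul_dotProduct, dotProduct_smul, smul_eq_mul, smul_eq_mul, ← mul_assoc, ← mul_inv,
      Real.mul_self_sqrt hpos.le, inv_mul_cancel₀ hpos.ne']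
  · rw [mulVec_smul, hv, smul_comm]

/-- If `1` is fixed by `A` and the second eigenvalue `μ` of `A` is below `1`, the quadratic form
of `A` is bounded by `μ` on the orthogonal complement of `1`. -/
theorem dotProduct_mulVec_le_of_sum_eq_zero [Nontrivial n] (hA : A.IsHermitian)
    (h1 : A *ᵥ 1 = 1) (hgap : hA.eigenvalues₀ ⟨1, Fintype.one_lt_card⟩ < 1)
    {x : n → ℝ} (hx : 1 ⬝ᵥ x = 0) :
    x ⬝ᵥ (A *ᵥ x) ≤ hA.eigenvalues₀ ⟨1, Fintype.one_lt_card⟩ * (x ⬝ᵥ x) := by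
  set e := Fintype.equivOfCardEq (Fintype.card_fin (Fintype.card n)) with he
  set i₀ : n := e ⟨0, Fintype.card_pos⟩ with hi₀
  have hle : ∀ i, i ≠ i₀ → hA.eigenvalues i ≤ hA.eigenvalues₀ ⟨1, Fintype.one_lt_card⟩ := by
    intro i hi
    refine hA.eigenvalues₀_antitone ?_
    rw [Fin.le_def]
    change 1 ≤ (e.symm i).val
    by_contra! hlt
    apply hi
    rw [hi₀, ← e.apply_symm_apply i]
    congr 1
    ext
    simpa using hlt
  -- Eigenvectors with eigenvalue other than `1` are orthogonal to the fixed vector `1`, so only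
  -- index `i₀` can carry it.
  have hzero : ∀ i, i ≠ i₀ → ⇑(hA.eigenvectorBasis i) ⬝ᵥ (1 : n → ℝ) = 0 := by
    intro i hi
    have h := eigenvectorBasis_dotProduct_mulVec hA 1 i
    rw [h1] at h
    by_contra h0
    have : hA.eigenvalues i = 1 := by
      field_simp at h
      exact h.symm
    linarith [hle i hi]
  have hi₀1 : ⇑(hA.eigenvectorBasis i₀) ⬝ᵥ (1 : n → ℝ) ≠ 0 := by
    intro h0
    have h := dotProduct_eq_sum_eigenvectorBasis hA (1 : n → ℝ) 1
    rw [Finset.sum_eq_zero] at h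
    · simp at h
    · intro i _
      by_cases hi : i = i₀
      · rw [hi, h0, zero_mul]
      · rw [hzero i hi, zero_mul]
  refine dotProduct_mulVec_le_of_eigenvalues hA fun i => ?_
  by_cases hi : i = i₀
  · left
    rw [dotProduct_eq_sum_eigenvectorBasis hA 1 x, Finset.sum_eq_single i₀] at hx
    · rw [hi]
      exact (mul_eq_zero.mp hx).resolve_left hi₀1
    · intro j _ hj
      rw [hzero j hj, zero_mul]
    · simp
  · exact Or.inr (hle i hi)

end Spectral

/-! ### Two-sided bounds for the Neumann series of a nonnegative matrix. -/

section Resolvent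

variable {U : Type*} [Fintype U] [DecidableEq U] {B : Matrix U U ℝ}

theorem pow_mulVec_one_nonneg (hB : ∀ i j, 0 ≤ B i j) (n : ℕ) (i : U) :
    0 ≤ (B ^ n *ᵥ 1) i := by
  induction n generalizing i with
  | zero => simp
  | succ n ih =>
    rw [pow_succ', ← mulVec_mulVec]
    exact Finset.sum_nonneg fun j _ => mul_nonneg (hB i j) (ih j)

theorem sum_range_pow_mulVec_sub (M : ℕ) :
    (∑ k ∈ Finset.range M, B ^ k *ᵥ 1) - B *ᵥ (∑ k ∈ Finset.range M, B ^ k *ᵥ 1)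
      = 1 - B ^ M *ᵥ 1 := by
  induction M with
  | zero => simp
  | succ M ih =>
    rw [Finset.sum_range_succ, mulVec_add, add_sub_add_comm, ih, pow_succ', mulVec_mulVec]
    abel

variable {μ : ℝ}

/-- With `S` the partial sum, telescoping and nonnegativity give `(1 - μ) (S ⬝ᵥ S) ≤ S ⬝ᵥ 1`;
Cauchy–Schwarz then bounds `S ⬝ᵥ 1`. No inverse of `1 - B` is needed. -/
theorem sum_range_le_of_dotProduct_mulVec_le (hB : ∀ i j, 0 ≤ B i j)
    (hμ : ∀ x : U → ℝ, x ⬝ᵥ (B *ᵥ x) ≤ μ * (x ⬝ᵥ x)) (hμ1 : μ < 1) (M : ℕ) :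
    ∑ k ∈ Finset.range M, 1 ⬝ᵥ (B ^ k *ᵥ 1) ≤ Fintype.card U / (1 - μ) := by
  set S : U → ℝ := ∑ k ∈ Finset.range M, B ^ k *ᵥ 1 with hS
  have hSn : ∀ i, 0 ≤ S i := fun i => by
    rw [hS, Finset.sum_apply]
    exact Finset.sum_nonneg fun k _ => pow_mulVec_one_nonneg hB k i
  have h1 : S ⬝ᵥ S - S ⬝ᵥ (B *ᵥ S) = S ⬝ᵥ 1 - S ⬝ᵥ (B ^ M *ᵥ 1) := by
    rw [← dotProduct_sub, ← dotProduct_sub, hS, sum_range_pow_mulVec_sub]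
  have h2 : 0 ≤ S ⬝ᵥ (B ^ M *ᵥ 1) :=
    Finset.sum_nonneg fun i _ => mul_nonneg (hSn i) (pow_mulVec_one_nonneg hB M i)
  have h3 := hμ S
  have h4 : (S ⬝ᵥ 1) ^ 2 ≤ Fintype.card U * (S ⬝ᵥ S) := by
    simpa [dotProduct, sq] using sq_sum_le_card_mul_sum_sq (s := Finset.univ) (f := S)
  have h5 : 0 ≤ S ⬝ᵥ 1 := Finset.sum_nonneg fun i _ => mul_nonneg (hSn i) zero_le_one
  rw [← dotProduct_sum, dotProduct_comm, ← hS, le_div_iff₀ (by linarith)]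
  rcases h5.eq_or_lt with h6 | h6
  · rw [← h6]; simp
  · have h7 : (1 - μ) * (S ⬝ᵥ S) ≤ S ⬝ᵥ 1 := by linarith
    have h8 : (0 : ℝ) ≤ Fintype.card U := Nat.cast_nonneg _
    have h9 : (S ⬝ᵥ 1) * ((S ⬝ᵥ 1) * (1 - μ)) ≤ (S ⬝ᵥ 1) * Fintype.card U := by
      nlinarith [mul_le_mul_of_nonneg_left h7 h8,
        mul_le_mul_of_nonneg_left h4 (sub_nonneg.mpr hμ1.le)]
    exact le_of_mul_le_mul_left h9 h6

theorem one_dotProduct_pow_mulVec_nonneg (hB : ∀ i j, 0 ≤ B i j) (n : ℕ) :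
    0 ≤ 1 ⬝ᵥ (B ^ n *ᵥ 1) :=
  Finset.sum_nonneg fun i _ => mul_nonneg zero_le_one (pow_mulVec_one_nonneg hB n i)

theorem summable_dotProduct_pow_mulVec (hB : ∀ i j, 0 ≤ B i j)
    (hμ : ∀ x : U → ℝ, x ⬝ᵥ (B *ᵥ x) ≤ μ * (x ⬝ᵥ x)) (hμ1 : μ < 1) :
    Summable fun k : ℕ => 1 ⬝ᵥ (B ^ k *ᵥ 1) :=
  summable_of_sum_range_le (one_dotProduct_pow_mulVec_nonneg hB)
    (sum_range_le_of_dotProduct_mulVec_le hB hμ hμ1)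

theorem tsum_dotProduct_pow_mulVec_le (hB : ∀ i j, 0 ≤ B i j)
    (hμ : ∀ x : U → ℝ, x ⬝ᵥ (B *ᵥ x) ≤ μ * (x ⬝ᵥ x)) (hμ1 : μ < 1) :
    ∑' k : ℕ, 1 ⬝ᵥ (B ^ k *ᵥ 1) ≤ Fintype.card U / (1 - μ) :=
  Real.tsum_le_of_sum_range_le (one_dotProduct_pow_mulVec_nonneg hB)
    (sum_range_le_of_dotProduct_mulVec_le hB hμ hμ1)

/-- The form of `1 - B` is nonnegative at `S - t • v`; expanding bounds the partial sum from below,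
up to an error that vanishes as `M → ∞`. -/
theorem le_tsum_dotProduct_pow_mulVec (hBs : B.IsHermitian) (hB : ∀ i j, 0 ≤ B i j)
    (hμ : ∀ x : U → ℝ, x ⬝ᵥ (B *ᵥ x) ≤ μ * (x ⬝ᵥ x)) (hμ1 : μ < 1)
    {v : U → ℝ} (hv1 : v ⬝ᵥ v = 1) (hv : B *ᵥ v = μ • v) :
    (v ⬝ᵥ 1) ^ 2 / (1 - μ) ≤ ∑' k : ℕ, 1 ⬝ᵥ (B ^ k *ᵥ 1) := by
  have hT : Bᵀ = B := by simpa using hBs.eq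
  have hsum := summable_dotProduct_pow_mulVec hB hμ hμ1
  -- Each entry of `B ^ M *ᵥ 1` is at most the total, a term of a summable series.
  have hlim : Tendsto (fun M : ℕ => B ^ M *ᵥ (1 : U → ℝ)) atTop (𝓝 0) := by
    rw [tendsto_pi_nhds]
    intro i
    refine squeeze_zero (fun M => pow_mulVec_one_nonneg hB M i) (fun M => ?_)
      hsum.tendsto_atTop_zero
    simpa [dotProduct] using Finset.single_le_sum
      (f := fun j => (B ^ M *ᵥ (1 : U → ℝ)) j)
      (fun j _ => pow_mulVec_one_nonneg hB M j) (Finset.mem_univ i)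
  have hd : 0 < 1 - μ := by linarith
  -- The coefficient along `v` of the limit `(1 - B)⁻¹ 1`.
  set t : ℝ := (v ⬝ᵥ 1) / (1 - μ) with ht
  have key : ∀ M : ℕ, (v ⬝ᵥ 1) ^ 2 / (1 - μ) - 2 * t * (v ⬝ᵥ (B ^ M *ᵥ 1)) ≤
      ∑ k ∈ Finset.range M, 1 ⬝ᵥ (B ^ k *ᵥ 1) := by
    intro M
    rw [← dotProduct_sum, dotProduct_comm 1 (∑ k ∈ Finset.range M, B ^ k *ᵥ 1)]
    have hSn : ∀ i, 0 ≤ (∑ k ∈ Finset.range M, B ^ k *ᵥ (1 : U → ℝ)) i := fun i => by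
      rw [Finset.sum_apply]
      exact Finset.sum_nonneg fun k _ => pow_mulVec_one_nonneg hB k i
    have hS := sum_range_pow_mulVec_sub (B := B) M
    generalize ∑ k ∈ Finset.range M, B ^ k *ᵥ (1 : U → ℝ) = S at hSn hS ⊢
    have h1 : S ⬝ᵥ S - S ⬝ᵥ (B *ᵥ S) = S ⬝ᵥ 1 - S ⬝ᵥ (B ^ M *ᵥ 1) := by
      rw [← dotProduct_sub, ← dotProduct_sub, hS]
    have h2 : 0 ≤ S ⬝ᵥ (B ^ M *ᵥ 1) :=
      Finset.sum_nonneg fun i _ => mul_nonneg (hSn i) (pow_mulVec_one_nonneg hB M i)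
    have h3 : v ⬝ᵥ S - v ⬝ᵥ (B *ᵥ S) = v ⬝ᵥ 1 - v ⬝ᵥ (B ^ M *ᵥ 1) := by
      rw [← dotProduct_sub, ← dotProduct_sub, hS]
    have h4 : v ⬝ᵥ (B *ᵥ S) = μ * (v ⬝ᵥ S) := by
      rw [dotProduct_mulVec, ← mulVec_transpose, hT, hv, smul_dotProduct, smul_eq_mul]
    have h5 : (S - t • v) ⬝ᵥ (B *ᵥ (S - t • v)) ≤ (S - t • v) ⬝ᵥ (S - t • v) :=
      (hμ _).trans (mul_le_of_le_one_left
        (Finset.sum_nonneg fun i _ => mul_self_nonneg _) hμ1.le)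
    simp only [mulVec_sub, mulVec_smul, hv, sub_dotProduct, dotProduct_sub, smul_dotProduct,
      dotProduct_smul, smul_eq_mul, h4, hv1, dotProduct_comm S v] at h5
    have h6 : v ⬝ᵥ 1 = t * (1 - μ) := by rw [ht]; field_simp
    rw [h6] at h3 ⊢
    have h7 : (t * (1 - μ)) ^ 2 / (1 - μ) = t ^ 2 * (1 - μ) := by field_simp
    rw [h7]
    have h8 : v ⬝ᵥ (B ^ M *ᵥ 1) = t * (1 - μ) - (1 - μ) * (v ⬝ᵥ S) := by linarith
    rw [h8]
    nlinarith [h1, h2, h5]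
  have hl : Tendsto (fun M : ℕ => (v ⬝ᵥ 1) ^ 2 / (1 - μ) - 2 * t * (v ⬝ᵥ (B ^ M *ᵥ 1))) atTop
      (𝓝 ((v ⬝ᵥ 1) ^ 2 / (1 - μ) - 2 * t * (v ⬝ᵥ 0))) := by
    refine tendsto_const_nhds.sub (Tendsto.const_mul _ ?_)
    exact ((Continuous.dotProduct continuous_const continuous_id).tendsto 0).comp hlim
  simp only [dotProduct_zero, mul_zero, sub_zero] at hl
  exact le_of_tendsto_of_tendsto' hl hsum.hasSum.tendsto_sum_nat key

end Resolvent

theorem sum_ite_mem_eq_sum_subtype {V M : Type*} [Fintype V] [DecidableEq V] [AddCommMonoid M]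
    (T : Finset V) (f : V → M) :
    ∑ v, (if v ∈ T then 0 else f v) = ∑ v : {v // v ∉ T}, f v := by
  rw [← Finset.sum_subtype Tᶜ (fun v => Finset.mem_compl) f]
  simp_rw [← ite_not (_ ∈ T), ← Finset.mem_compl]
  exact (Finset.sum_ite_mem _ _ _).trans (by rw [Finset.univ_inter])

/-! ### The walk matrices and the transition probabilities. -/

section Matrix

variable {V : Type*} {G : SimpleGraph V} [DecidableRel G.Adj] {d : ℕ}

theorem normAdjMatrix_nonneg (u v : V) : 0 ≤ normAdjMatrix G d u v := by
  simp only [normAdjMatrix, of_apply]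
  split_ifs <;> positivity

theorem leakingWalkMatrix_nonneg (T : Finset V) (u v) : 0 ≤ leakingWalkMatrix G d T u v :=
  normAdjMatrix_nonneg _ _

theorem leakingWalkMatrix_isHermitian (T : Finset V) : (leakingWalkMatrix G d T).IsHermitian :=
  (normAdjMatrix_isHermitian G d).submatrix _

variable [Fintype V]

theorem normAdjMatrix_mulVec_one (hd : 0 < d) (hG : G.IsRegularOfDegree d) :
    normAdjMatrix G d *ᵥ 1 = 1 := by
  ext u
  have h : (Finset.univ.filter (G.Adj u)).card = d := by
    rw [← SimpleGraph.neighborFinset_eq_filter, SimpleGraph.card_neighborFinset_eq_degree, hG u]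
  simp [mulVec, dotProduct, normAdjMatrix, ← Finset.sum_filter, h, hd.ne']

variable [DecidableEq V]

theorem stepPMF_apply (hd : 0 < d) (hG : G.IsRegularOfDegree d) (u v : V) :
    stepPMF G u v = ENNReal.ofReal (normAdjMatrix G d u v) := by
  have h : (G.neighborFinset u).card = d := by
    rw [SimpleGraph.card_neighborFinset_eq_degree, hG u]
  -- Positive degree rules out the stay-in-place branch of `stepPMF`.
  have hne : (G.neighborFinset u).Nonempty := Finset.card_pos.mp (h ▸ hd)
  rw [stepPMF, dif_pos hne, PMF.uniformOfFinset_apply, h, normAdjMatrix, of_apply]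
  simp only [SimpleGraph.mem_neighborFinset]
  split_ifs
  · rw [one_div, ENNReal.ofReal_inv_of_pos (by positivity), ENNReal.ofReal_natCast]
  · simp

end Matrix

/-- Tail-sum formula: the hitting time counts the `n` with no visit to `T` up to time `n`, including
when it is infinite. -/
theorem toENNReal_hittingTime {V : Type*} [DecidableEq V] (T : Finset V) (ω : ℕ → V) :
    (hittingTime T ω : ℝ≥0∞) = ∑' n : ℕ, if ∀ i ≤ n, ω i ∉ T then 1 else 0 := by
  have hlt : ∀ n : ℕ, (∀ i ≤ n, ω i ∉ T) ↔ (n : ℕ∞) < hittingTime T ω := by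
    intro n
    rw [← not_le, hittingTime]
    erw [hittingAfter_le_iff]
    simp
  simp_rw [hlt]
  generalize hittingTime T ω = t
  induction t with
  | top => simp
  | coe m =>
    rw [tsum_eq_sum (s := Finset.range m) (fun n hn => by simpa using hn)]
    simp only [Nat.cast_lt]
    rw [Finset.sum_congr rfl (fun n hn => if_pos (Finset.mem_range.mp hn))]
    simp

/-! ### From the trajectory measure to powers of the leaking matrix. -/

section Law

variable {V : Type*} [Fintype V] [DecidableEq V] [MeasurableSpace V] [DiscreteMeasurableSpace V]
  (G : SimpleGraph V) [DecidableRel G.Adj]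

theorem lintegral_walkLaw_zero [Nonempty V] (f : V → ℝ≥0∞) :
    ∫⁻ ω, f (ω 0) ∂(walkLaw G) = ∑ v, f v * (Fintype.card V : ℝ≥0∞)⁻¹ := by
  have h : (walkLaw G).map (fun ω => ω 0) = (PMF.uniformOfFintype V).toMeasure := by
    have h0 : (walkLaw G).map (Preorder.frestrictLe (π := fun _ : ℕ => V) 0) =
        (PMF.uniformOfFintype V).toMeasure.map
          (MeasurableEquiv.piUnique (fun _ : Finset.Iic (0 : ℕ) => V)).symm := by
      rw [walkLaw, Kernel.trajMeasure, Measure.map_comp _ _ (by fun_prop),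
        Kernel.traj_map_frestrictLe, Kernel.partialTraj_self, Measure.id_comp]
    have h1 : (fun ω : ℕ → V => ω 0) =
        (MeasurableEquiv.piUnique (fun _ : Finset.Iic (0 : ℕ) => V)) ∘
          Preorder.frestrictLe (π := fun _ : ℕ => V) 0 := rfl
    rw [h1, ← Measure.map_map (by fun_prop) (by fun_prop), h0]
    exact MeasurableEquiv.map_map_symm _
  rw [← lintegral_map (μ := walkLaw G) (g := fun ω => ω 0) (f := f) .of_discrete
    (measurable_pi_apply 0), h, lintegral_fintype]
  simp

/-- One step of the walk, killed on `T`, acting on functions. -/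
def killedStep (T : Finset V) (φ : V → ℝ≥0∞) (u : V) : ℝ≥0∞ :=
  ∫⁻ w, (if w ∈ T then 0 else φ w) ∂(stepPMF G u).toMeasure

/-- Markov property: the last step is integrated out conditionally on the history up to time `n`. -/
theorem lintegral_walkLaw_succ [Nonempty V] (T : Finset V) (φ : V → ℝ≥0∞) (n : ℕ) :
    ∫⁻ ω, (if ∀ i ≤ n + 1, ω i ∉ T then φ (ω (n + 1)) else 0) ∂(walkLaw G) =
      ∫⁻ ω, (if ∀ i ≤ n, ω i ∉ T then killedStep G T φ (ω n) else 0) ∂(walkLaw G) := by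
  classical
  have h := Kernel.map_frestrictLe_trajMeasure_compProd_eq_map_trajMeasure (X := fun _ => V)
    (μ₀ := (PMF.uniformOfFintype V).toMeasure) (κ := stepKernel G) (a := n)
  change (walkLaw G).map _ ⊗ₘ _ = (walkLaw G).map _ at h
  let F : (Finset.Iic n → V) × V → ℝ≥0∞ := fun p =>
    if ∀ i, p.1 i ∉ T then (if p.2 ∈ T then 0 else φ p.2) else 0
  have h1 : ∀ ω : ℕ → V, (if ∀ i ≤ n + 1, ω i ∉ T then φ (ω (n + 1)) else 0) =
      F (Preorder.frestrictLe (π := fun _ : ℕ => V) n ω, ω (n + 1)) := by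
    intro ω
    have : (∀ i ≤ n + 1, ω i ∉ T) ↔ (∀ i ≤ n, ω i ∉ T) ∧ ω (n + 1) ∉ T := by
      constructor
      · exact fun h => ⟨fun i hi => h i (by omega), h _ le_rfl⟩
      · rintro ⟨h, h'⟩ i hi
        rcases Nat.le_succ_iff.mp hi with hi | rfl
        exacts [h i hi, h']
    simp only [F, this, Subtype.forall, Finset.mem_Iic, Preorder.frestrictLe_apply]
    split_ifs <;> simp_all
  simp_rw [h1]
  rw [← lintegral_map (μ := walkLaw G) (f := F)
    (g := fun ω => (Preorder.frestrictLe (π := fun _ : ℕ => V) n ω, ω (n + 1)))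
    .of_discrete (by fun_prop), ← h, Measure.lintegral_compProd .of_discrete,
    lintegral_map .of_discrete (by fun_prop)]
  refine lintegral_congr fun ω => ?_
  simp only [F, Subtype.forall, Finset.mem_Iic, Preorder.frestrictLe_apply]
  split_ifs with hω
  · rfl
  · simp

theorem lintegral_walkLaw_killed [Nonempty V] (T : Finset V) (φ : V → ℝ≥0∞) (n : ℕ) :
    ∫⁻ ω, (if ∀ i ≤ n, ω i ∉ T then φ (ω n) else 0) ∂(walkLaw G) =
      ∑ v, (if v ∈ T then 0 else (killedStep G T)^[n] φ v) * (Fintype.card V : ℝ≥0∞)⁻¹ := by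
  induction n generalizing φ with
  | zero =>
    rw [← lintegral_walkLaw_zero G]
    refine lintegral_congr fun ω => ?_
    by_cases h : ω 0 ∈ T <;> simp [h]
  | succ n ih => rw [lintegral_walkLaw_succ, ih, Function.iterate_succ_apply]

theorem averageHittingTime_eq_tsum [Nonempty V] (T : Finset V) :
    averageHittingTime G T = ∑' n : ℕ, ∑ v,
      (if v ∈ T then 0 else (killedStep G T)^[n] 1 v) * (Fintype.card V : ℝ≥0∞)⁻¹ := by
  simp_rw [averageHittingTime, toENNReal_hittingTime]
  rw [lintegral_tsum]
  · exact tsum_congr fun n => lintegral_walkLaw_killed G T 1 n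
  · intro n
    refine (Measurable.ite ?_ measurable_const measurable_const).aemeasurable
    have : {ω : ℕ → V | ∀ i ≤ n, ω i ∉ T} = ⋂ i ∈ Set.Iic n, (fun ω => ω i) ⁻¹' (T : Set V)ᶜ := by
      ext; simp
    rw [this]
    exact MeasurableSet.biInter (Set.to_countable _) fun i _ =>
      measurable_pi_apply i (.of_discrete)

variable {G} {d : ℕ}

theorem iterate_killedStep_one (hd : 0 < d) (hG : G.IsRegularOfDegree d) (T : Finset V) (n : ℕ)
    (u : {v // v ∉ T}) :
    (killedStep G T)^[n] 1 u = ENNReal.ofReal ((leakingWalkMatrix G d T ^ n *ᵥ 1) u) := by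
  induction n generalizing u with
  | zero => simp
  | succ n ih =>
    rw [Function.iterate_succ_apply', killedStep, lintegral_fintype, pow_succ', ← mulVec_mulVec,
      mulVec, dotProduct, ENNReal.ofReal_sum_of_nonneg (fun v _ => mul_nonneg
        (leakingWalkMatrix_nonneg T u v) (pow_mulVec_one_nonneg (leakingWalkMatrix_nonneg T) n v))]
    have h : ∀ w, (if w ∈ T then 0 else (killedStep G T)^[n] 1 w) *
        (stepPMF G u).toMeasure {w} =
        if w ∈ T then 0 else (killedStep G T)^[n] 1 w * ENNReal.ofReal (normAdjMatrix G d u w) := by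
      intro w
      rw [PMF.toMeasure_apply_singleton _ _ (.of_discrete), stepPMF_apply hd hG]
      split_ifs <;> simp
    simp_rw [h]
    rw [sum_ite_mem_eq_sum_subtype]
    refine Finset.sum_congr rfl fun v _ => ?_
    rw [ih, mul_comm, ENNReal.ofReal_mul (leakingWalkMatrix_nonneg T u v)]
    rfl

theorem averageHittingTime_eq_tsum_leaking [Nonempty V] (hd : 0 < d) (hG : G.IsRegularOfDegree d)
    (T : Finset V) :
    averageHittingTime G T = (∑' n : ℕ, ENNReal.ofReal (1 ⬝ᵥ (leakingWalkMatrix G d T ^ n *ᵥ 1))) *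
      (Fintype.card V : ℝ≥0∞)⁻¹ := by
  rw [averageHittingTime_eq_tsum, ← ENNReal.tsum_mul_right]
  refine tsum_congr fun n => ?_
  rw [← Finset.sum_mul, one_dotProduct, ENNReal.ofReal_sum_of_nonneg
    (fun v _ => pow_mulVec_one_nonneg (leakingWalkMatrix_nonneg T) n v)]
  simp_rw [← iterate_killedStep_one hd hG]
  rw [sum_ite_mem_eq_sum_subtype]

end Law

/-! ### Overlap of the principal eigenvector with the uniform vector. -/

section Gap

theorem sum_eq_sum_subtype_of_forall_mem {V M : Type*} [Fintype V] [DecidableEq V]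
    [AddCommMonoid M] {T : Finset V} {f : V → M} (hf : ∀ v ∈ T, f v = 0) :
    ∑ v, f v = ∑ v : {v // v ∉ T}, f v := by
  rw [← sum_ite_mem_eq_sum_subtype]
  refine Finset.sum_congr rfl fun v _ => ?_
  split_ifs with h
  exacts [hf v h, rfl]

/-- The component of `w` along `1` is fixed by `A`; the rest has squared norm `1 - (1 ⬝ᵥ w) ^ 2 / N`
and loses at least the gap. -/
theorem gap_mul_one_sub_le {n : Type*} [Fintype n] [DecidableEq n] [Nontrivial n]
    {A : Matrix n n ℝ} (hA : A.IsHermitian) (h1 : A *ᵥ 1 = 1)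
    (hgap : hA.eigenvalues₀ ⟨1, Fintype.one_lt_card⟩ < 1) {w : n → ℝ} (hw : w ⬝ᵥ w = 1) :
    (1 - hA.eigenvalues₀ ⟨1, Fintype.one_lt_card⟩) * (1 - (1 ⬝ᵥ w) ^ 2 / Fintype.card n) ≤
      1 - w ⬝ᵥ (A *ᵥ w) := by
  have hT : Aᵀ = A := by simpa using hA.eq
  have hN : (Fintype.card n : ℝ) ≠ 0 := by simp
  have h11 : (1 : n → ℝ) ⬝ᵥ 1 = Fintype.card n := by simp
  have hA1 : (1 : n → ℝ) ⬝ᵥ (A *ᵥ w) = 1 ⬝ᵥ w := by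
    rw [dotProduct_mulVec, ← mulVec_transpose, hT, h1]
  set t : ℝ := (1 ⬝ᵥ w) / Fintype.card n with ht
  have hp : 1 ⬝ᵥ w = t * Fintype.card n := by rw [ht]; field_simp
  have h := dotProduct_mulVec_le_of_sum_eq_zero hA h1 hgap (x := w - t • 1) (by
    rw [dotProduct_sub, dotProduct_smul, h11, hp, smul_eq_mul, sub_self])
  simp only [mulVec_sub, mulVec_smul, h1, sub_dotProduct, dotProduct_sub, smul_dotProduct,
    dotProduct_smul, smul_eq_mul, hA1, hw, h11, dotProduct_comm w 1, hp] at h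
  rw [hp]
  have h2 : (t * Fintype.card n) ^ 2 / (Fintype.card n : ℝ) = t * (t * Fintype.card n) := by
    field_simp
  rw [h2]
  linarith

variable {V : Type*} [Fintype V] [DecidableEq V] {G : SimpleGraph V} [DecidableRel G.Adj]
  {d : ℕ}

theorem spectralGap_mul_one_sub_le [Nontrivial V] (hd : 0 < d) (hG : G.IsRegularOfDegree d)
    (hgap : 0 < spectralGap G d) {T : Finset V} {v : {v // v ∉ T} → ℝ} {μ : ℝ}
    (hv1 : v ⬝ᵥ v = 1) (hv : leakingWalkMatrix G d T *ᵥ v = μ • v) :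
    spectralGap G d * (1 - (v ⬝ᵥ 1) ^ 2 / Fintype.card V) ≤ 1 - μ := by
  let w : V → ℝ := fun x => if h : x ∉ T then v ⟨x, h⟩ else 0
  have hwT : ∀ x ∈ T, w x = 0 := fun x hx => by simp [w, hx]
  have hwU : ∀ x : {v // v ∉ T}, w x = v x := fun x => dif_pos x.2
  have hw1 : w ⬝ᵥ w = 1 := by
    rw [← hv1, dotProduct, sum_eq_sum_subtype_of_forall_mem (T := T)
      (fun x hx => by simp [hwT x hx])]
    simp [dotProduct, hwU]
  have hw : 1 ⬝ᵥ w = v ⬝ᵥ 1 := by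
    rw [dotProduct, sum_eq_sum_subtype_of_forall_mem (T := T) (fun x hx => by simp [hwT x hx])]
    simp [dotProduct, hwU]
  have hAw : ∀ x : {v // v ∉ T}, (normAdjMatrix G d *ᵥ w) x = μ * v x := by
    intro x
    have := congrFun hv x
    rw [Pi.smul_apply, smul_eq_mul] at this
    rw [← this, mulVec, dotProduct,
      sum_eq_sum_subtype_of_forall_mem (T := T) (fun x hx => by simp [hwT x hx])]
    simp [mulVec, dotProduct, hwU, leakingWalkMatrix]
  have hq : w ⬝ᵥ (normAdjMatrix G d *ᵥ w) = μ := by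
    rw [dotProduct, sum_eq_sum_subtype_of_forall_mem (T := T) (fun x hx => by simp [hwT x hx])]
    simp_rw [hwU, hAw, mul_left_comm _ μ, ← Finset.mul_sum]
    rw [← dotProduct, hv1, mul_one]
  have h := gap_mul_one_sub_le (normAdjMatrix_isHermitian G d) (normAdjMatrix_mulVec_one hd hG)
    (sub_pos.mp hgap) hw1
  rwa [hq, hw] at h

/-- The diagonal vanishes, so the quadratic form is zero at a basis vector. -/
theorem IsPrincipalEigenvalue.leakingWalkMatrix_nonneg {T : Finset V} (hT : T ≠ Finset.univ)
    {μ : ℝ} (hμ : IsPrincipalEigenvalue (leakingWalkMatrix G d T) μ) : 0 ≤ μ := by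
  obtain ⟨u, hu⟩ : ∃ u, u ∉ T := by
    by_contra! h
    exact hT (Finset.eq_univ_iff_forall.mpr h)
  simpa [leakingWalkMatrix, normAdjMatrix] using
    hμ.dotProduct_mulVec_le (leakingWalkMatrix_isHermitian T) (Pi.single ⟨u, hu⟩ 1)

end Gap

theorem averageHittingTime_eq_ofReal {V : Type*} [Fintype V] [DecidableEq V] [Nonempty V]
    [MeasurableSpace V] [DiscreteMeasurableSpace V] {G : SimpleGraph V} [DecidableRel G.Adj]
    {d : ℕ} (hd : 0 < d) (hG : G.IsRegularOfDegree d) {T : Finset V} {μ : ℝ}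
    (hμ : IsPrincipalEigenvalue (leakingWalkMatrix G d T) μ) (hμ1 : μ < 1) :
    averageHittingTime G T = ENNReal.ofReal
      ((∑' k : ℕ, 1 ⬝ᵥ (leakingWalkMatrix G d T ^ k *ᵥ 1)) / Fintype.card V) := by
  rw [averageHittingTime_eq_tsum_leaking hd hG, ← ENNReal.ofReal_tsum_of_nonneg
    (one_dotProduct_pow_mulVec_nonneg (leakingWalkMatrix_nonneg T))
    (summable_dotProduct_pow_mulVec (leakingWalkMatrix_nonneg T)
      (hμ.dotProduct_mulVec_le (leakingWalkMatrix_isHermitian T)) hμ1),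
    ENNReal.ofReal_div_of_pos (by positivity), ENNReal.ofReal_natCast, div_eq_mul_inv]

theorem averageHittingTime_bounds {V : Type*} [Fintype V] [DecidableEq V] [Nontrivial V]
    [MeasurableSpace V] [DiscreteMeasurableSpace V] {G : SimpleGraph V} [DecidableRel G.Adj]
    {d : ℕ} {T : Finset V} {α : ℝ} (hd : 0 < d) (hG : G.IsRegularOfDegree d) (hTne : T.Nonempty)
    (hTun : T ≠ Finset.univ) (hα : α ∈ Set.Icc 0 Real.pi)
    (hμ : IsPrincipalEigenvalue (leakingWalkMatrix G d T) (Real.cos α))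
    (hgap : 2 * Real.sin α ^ 2 < spectralGap G d) :
    0 < α ∧ ENNReal.ofReal (1 * (1 / α ^ 2)) ≤ averageHittingTime G T ∧
      averageHittingTime G T ≤ ENNReal.ofReal (Real.pi ^ 2 / 2 * (1 / α ^ 2)) := by
  have hcos0 : 0 ≤ Real.cos α := hμ.leakingWalkMatrix_nonneg hTun
  have hcos1 : Real.cos α ≤ 1 := Real.cos_le_one α
  have hg0 : 0 < spectralGap G d := lt_of_le_of_lt (by positivity) hgap
  obtain ⟨v, hv1, hv⟩ := hμ.exists_unit_eigenvector
  have hN : (0 : ℝ) < Fintype.card V := by exact_mod_cast Fintype.card_pos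
  have hU : (Fintype.card {v // v ∉ T} : ℝ) < Fintype.card V := by
    obtain ⟨x, hx⟩ := hTne
    exact_mod_cast Fintype.card_subtype_lt (p := fun v => v ∉ T) (x := x) (not_not.mpr hx)
  have hcs : (v ⬝ᵥ 1) ^ 2 ≤ Fintype.card {v // v ∉ T} := by
    have h : (∑ i, v i) ^ 2 ≤ Fintype.card {v // v ∉ T} * ∑ i, v i ^ 2 :=
      sq_sum_le_card_mul_sum_sq
    have h' : ∑ i, v i ^ 2 = 1 := by rw [← hv1, dotProduct]; simp_rw [sq]
    simpa [h', dotProduct] using h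
  have hoverlap := spectralGap_mul_one_sub_le hd hG hg0 hv1 hv
  set a : ℝ := (v ⬝ᵥ 1) ^ 2 / Fintype.card V with ha
  -- As `v` lives off the nonempty `T`, it cannot be fully aligned with `1`; this forces `cos α <
  -- 1`.
  have ha1 : a < 1 := by rw [ha, div_lt_one hN]; linarith
  have hlt : Real.cos α < 1 := by nlinarith [mul_pos hg0 (sub_pos.mpr ha1)]
  have hα0 : 0 < α := lt_of_le_of_ne hα.1 fun h => by simp [← h] at hlt
  have ha2 : 1 / 2 ≤ a := by
    have hsin : 1 - Real.cos α ≤ Real.sin α ^ 2 := by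
      nlinarith [Real.sin_sq_add_cos_sq α]
    -- If `a < 1/2`, then `g / 2 < g (1 - a) ≤ 1 - cos α ≤ sin² α < g / 2`.
    by_contra! h
    nlinarith
  have hd1 : 0 < 1 - Real.cos α := by linarith
  have hB := leakingWalkMatrix_nonneg (G := G) (d := d) T
  have hBs := leakingWalkMatrix_isHermitian (G := G) (d := d) T
  have hq := hμ.dotProduct_mulVec_le hBs
  rw [averageHittingTime_eq_ofReal hd hG hμ hlt]
  refine ⟨hα0, ENNReal.ofReal_le_ofReal ?_, ENNReal.ofReal_le_ofReal ?_⟩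
  · have h1 : 1 - Real.cos α ≤ α ^ 2 / 2 := by
      linarith [Real.one_sub_sq_div_two_le_cos (x := α)]
    calc 1 * (1 / α ^ 2) = 1 / 2 / (α ^ 2 / 2) := by field_simp
      _ ≤ a / (1 - Real.cos α) := by gcongr
      _ = (v ⬝ᵥ 1) ^ 2 / (1 - Real.cos α) / Fintype.card V := by rw [ha, div_right_comm]
      _ ≤ _ := by
        gcongr
        exact le_tsum_dotProduct_pow_mulVec hBs hB hq hlt hv1 hv
  · have h1 : 2 / Real.pi ^ 2 * α ^ 2 ≤ 1 - Real.cos α := by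
      linarith [Real.cos_le_one_sub_mul_cos_sq (x := α) (by rw [abs_of_pos hα0]; exact hα.2)]
    calc _ ≤ Fintype.card {v // v ∉ T} / (1 - Real.cos α) / Fintype.card V := by
          gcongr
          exact tsum_dotProduct_pow_mulVec_le hB hq hlt
      _ = Fintype.card {v // v ∉ T} / Fintype.card V / (1 - Real.cos α) := div_right_comm _ _ _
      _ ≤ 1 / (2 / Real.pi ^ 2 * α ^ 2) := by
          gcongr
          exact (div_le_one hN).mpr hU.le
      _ = _ := by field_simp

end RegularGraphWalk

end

theorem mainTheorem5 :
    ∃ c C : ℝ, 0 < c ∧ 0 < C ∧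
      ∀ (V : Type*) [Fintype V] [DecidableEq V] [Nontrivial V] [MeasurableSpace V]
        [DiscreteMeasurableSpace V] (G : SimpleGraph V) [DecidableRel G.Adj] (d : ℕ)
        (T : Finset V) (α : ℝ),
        0 < d → G.IsRegularOfDegree d → T.Nonempty → T ≠ Finset.univ →
        α ∈ Set.Icc 0 Real.pi →
        RegularGraphWalk.IsPrincipalEigenvalue
          (RegularGraphWalk.leakingWalkMatrix G d T) (Real.cos α) →
        2 * Real.sin α ^ 2 < RegularGraphWalk.spectralGap G d →
        0 < α ∧
          ENNReal.ofReal (c * (1 / α ^ 2)) ≤ RegularGraphWalk.averageHittingTime G T ∧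
          RegularGraphWalk.averageHittingTime G T ≤ ENNReal.ofReal (C * (1 / α ^ 2)) := by
  refine ⟨1, Real.pi ^ 2 / 2, one_pos, by positivity, ?_⟩
  intro V _ _ _ _ _ G _ d T α hd hG hTne hTun hα hμ hgap
  exact RegularGraphWalk.averageHittingTime_bounds hd hG hTne hTun hα hμ hgap
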